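/- A rooted chord diagram $C$ with $|C|=n$ chords consists of $2n$ points on a circle, one of which is distinguished as the root, the points being numbered $p_1,\dots,p_{2n}$ counterclockwise starting with $p_1$ the root, together with a partition of these points into $n$ pairs, called chords. The counterclockwise order of the chords is the order of their first endpoints. The directed intersection graph of $C$ has the chords as vertices and an edge $c\to d$ whenever the chords $c$ and $d$ cross and $c$ precedes $d$ in the counterclockwise order. The diagram is connected if $n\geq 1$ and its intersection graph is connected (ignoring directions). Let $\mathcal{RCCD}$ be the set of rooted connected chord diagrams. The intersection order of the chords of $C\in\mathcal{RCCD}$ is defined recursively on the intersection graph: the first chord in the counterclockwise order comes first; deleting its edges leaves, besides that chord, connected components, which are listed one after the other by increasing (in the counterclockwise order) smallest chord, the chords within each component being ordered recursively by the same procedure. Label the chords $1,\dots,n$ in the intersection order. A chord is terminal if it has no outgoing edge in the directed intersection graph. Let $t_1<t_2<\dots<t_{k+1}$ be the labels of the terminal chords of $C$, let $b(C)=t_1$, and let $\delta_m=t_{m+1}-t_m$ for $1\leq m\leq k$. Given elements $f_0,f_1,f_2,\dots$ of a commutative semiring, put $$f_C=f_0^{\,n-k-1}f_{\delta_1}f_{\delta_2}\cdots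 f_{\delta_k}.$$ Then for all integers $i\geq 1$ and $j\geq 1$, $$\sum_{\substack{C\in\mathcal{RCCD}\\ |C|=i+1\\ b(C)=j+1}} f_C=\sum_{k=1}^{i}\sum_{\ell=1}^{j}\binom{j}{\ell}\left(\sum_{\substack{C\in\mathcal{RCCD}\\ |C|=k\\ b(C)\geq \ell}} f_C\,f_{b(C)-\ell}\right)\left(\sum_{\substack{C\in\mathcal{RCCD}\\ |C|=i-k+1\\ b(C)=j-\ell+1}} f_C\right).$$ -/

import Mathlib

/-- A rooted chord diagram with `n` chords. The `2n` points on the circle are numbered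
`0, …, 2n-1` counterclockwise starting with the root, and the chords are the pairs
`{x, partner x}` for a fixed-point-free involution `partner`. -/
def RootedChordDiagram (n : ℕ) : Type :=
  {partner : Fin (2 * n) → Fin (2 * n) //
    (∀ x, partner (partner x) = x) ∧ ∀ x, partner x ≠ x}

instance (n : ℕ) : Fintype (RootedChordDiagram n) :=
  inferInstanceAs (Fintype {partner : Fin (2 * n) → Fin (2 * n) //
    (∀ x, partner (partner x) = x) ∧ ∀ x, partner x ≠ x})

section IntersectionOrder

variable {V : Type*} [Fintype V] [LinearOrder V] (G : SimpleGraph V) [DecidableRel G.Adj]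

/-- The vertex set of the connected component of `u` in the subgraph of `G` induced on `T`. -/
def componentIn (T : Finset V) (u : V) : Finset V :=
  {w ∈ T | (G.induce (T : Set V)).spanningCoe.Reachable u w}

/-- The recursive procedure behind the intersection order, on a finite graph with linearly
ordered vertices. The components of the subgraph induced on `T` are listed by increasing smallest
vertex; within each component `K` the smallest vertex `u` comes first, and the rest of `K`, i.e.
what is left of `K` once the edges at `u` are deleted, is treated recursively in the same way. -/
def componentwiseOrder (T : Finset V) : List V :=
  if h : T.Nonempty then
    T.min' h ::
      (componentwiseOrder ((componentIn G T (T.min' h)).erase (T.min' h)) ++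
        componentwiseOrder (T \ componentIn G T (T.min' h)))
  else []
termination_by T.card
decreasing_by
  · refine Finset.card_lt_card (Finset.ssubset_iff.2 ⟨T.min' h, by simp, ?_⟩)
    refine Finset.insert_subset (T.min'_mem h) ((Finset.erase_subset _ _).trans ?_)
    exact Finset.filter_subset _ _
  · refine Finset.card_lt_card (Finset.ssubset_iff.2 ⟨T.min' h, ?_, ?_⟩)
    · simp [componentIn, T.min'_mem h]
    · exact Finset.insert_subset (T.min'_mem h) Finset.sdiff_subset

end IntersectionOrder

namespace RootedChordDiagram

variable {n : ℕ} (C : RootedChordDiagram n)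

/-- The chords of `C`, each represented by the endpoint met first when going counterclockwise
from the root. The order inherited from `Fin (2 * n)` is the counterclockwise order of the
chords. -/
abbrev Chord : Type := {x : Fin (2 * n) // x < C.1 x}

/-- The directed intersection graph: there is an edge from `c` to `d` if the two chords intersect
and `c` precedes `d` in the counterclockwise order. -/
abbrev Edge (c d : C.Chord) : Prop := c.1 < d.1 ∧ d.1 < C.1 c.1 ∧ C.1 c.1 < C.1 d.1

/-- The underlying undirected intersection graph. -/
def intersectionGraph : SimpleGraph C.Chord where
  Adj c d := C.Edge c d ∨ C.Edge d c
  symm := ⟨fun _ _ h => h.symm⟩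
  loopless := ⟨fun _ h => (h.elim (·.1) (·.1)).false⟩

instance : DecidableRel C.intersectionGraph.Adj :=
  fun c d => inferInstanceAs (Decidable (C.Edge c d ∨ C.Edge d c))

/-- `C` is connected if the union of its chords, without the circle, is connected. -/
abbrev Connected : Prop := C.intersectionGraph.Connected

/-- A chord is terminal if it has no outgoing edge in the directed intersection graph. -/
abbrev IsTerminal (c : C.Chord) : Prop := ∀ d, ¬ C.Edge c d

/-- The list of all chords of `C` in the intersection order. -/
def intersectionOrder : List C.Chord := componentwiseOrder C.intersectionGraph Finset.univ

/-- The label in `{1, …, n}` of a chord in the intersection order. -/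
def label (c : C.Chord) : ℕ := C.intersectionOrder.idxOf c + 1

/-- The increasing sequence of the labels of the terminal chords. -/
def terminalLabels : List ℕ := (C.intersectionOrder.filter (C.IsTerminal ·)).map C.label

/-- The label of the first terminal chord (with value `0` for the empty diagram only). -/
def b : ℕ := C.terminalLabels.headD 0

/-- The sequence of differences of consecutive terminal labels. -/
def gaps : List ℕ := List.zipWith (fun s t => t - s) C.terminalLabels C.terminalLabels.tail

/-- The monomial `f_C = f₀ ^ (n - k - 1) * f_{δ₁} * ⋯ * f_{δₖ}`, where `δ₁, …, δₖ` are the gaps. -/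
def monomial {R : Type*} [CommSemiring R] (f : ℕ → R) : R :=
  f 0 ^ (n - C.gaps.length - 1) * (C.gaps.map f).prod

end RootedChordDiagram

/-- The finite set of rooted connected chord diagrams with `n` chords. -/
def RCCD (n : ℕ) : Finset (RootedChordDiagram n) := {C | C.Connected}

/-!
A connected diagram `C` with at least two chords arises in a unique way from two smaller connected
diagrams `R` and `D`: cut the sequence of the `2m` points of `D` in two nonempty pieces and put the
first piece directly after the root of `R` and the second one at the end. Here `D` is the component
of the chord through the second point of `C` once the root chord is deleted. In the intersection
order of `C` the root chord comes first, then the chords of `D`, then the other chords of `R`, so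
that `b C = b D + 1` and `f_C = f_R * f_{b R - 1} * f_D`.

Let `a j` and `h l` be the generating series, by number of chords, of the `f_C` with `b C = j + 1`
and of the `f_C * f_{b C - l}` with `b C ≥ l`, and let `θ` multiply the coefficient of `X ^ m` by
`2m - 1`. The decomposition gives `a (j + 1) = h 1 * θ (a j)` and `h (l + 1) = h 1 * θ (h l)`, and
`θ (a * b) = θ a * b + a * θ b + a * b`. Hence `h 1 * θ` sends `h l * a k` to
`h (l + 1) * a k + h l * a (k + 1) + h 1 * (h l * a k)`. Apply it to
`a j = ∑ l, j.choose l * (h l * a (j - l))`: the last terms add up to `h 1 * a j`, the term missing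
for Pascal's rule to give the same formula for `a (j + 1)`.
-/

section Order

theorem spanningCoe_induce_adj {V : Type*} (G : SimpleGraph V) {T : Finset V} {a b : V} :
    (G.induce (T : Set V)).spanningCoe.Adj a b ↔ a ∈ T ∧ b ∈ T ∧ G.Adj a b := by
  simp only [SimpleGraph.spanningCoe, SimpleGraph.map_adj]
  constructor
  · rintro ⟨x, y, h, rfl, rfl⟩
    exact ⟨x.2, y.2, h⟩
  · rintro ⟨ha, hb, h⟩
    exact ⟨⟨a, ha⟩, ⟨b, hb⟩, h, rfl, rfl⟩

theorem reachable_induction {V : Type*} {G : SimpleGraph V} {P : V → Prop} {u v : V}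
    (h : G.Reachable u v) (base : P u) (step : ∀ a b, P a → G.Adj a b → P b) : P v := by
  rw [SimpleGraph.reachable_iff_reflTransGen] at h
  induction h with
  | refl => exact base
  | tail _ hab ih => exact step _ _ ih hab

variable {V : Type*} [Fintype V] [LinearOrder V] (G : SimpleGraph V) [DecidableRel G.Adj]

theorem mem_componentIn {T : Finset V} {u w : V} :
    w ∈ componentIn G T u ↔ w ∈ T ∧ (G.induce (T : Set V)).spanningCoe.Reachable u w :=
  Finset.mem_filter

theorem componentIn_subset (T : Finset V) (u : V) : componentIn G T u ⊆ T :=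
  Finset.filter_subset _ _

theorem self_mem_componentIn {T : Finset V} {u : V} (hu : u ∈ T) : u ∈ componentIn G T u :=
  (mem_componentIn G).2 ⟨hu, SimpleGraph.Reachable.refl _⟩

theorem mem_componentIn_of_adj {T : Finset V} {u a b : V} (ha : a ∈ componentIn G T u)
    (hb : b ∈ T) (h : G.Adj a b) : b ∈ componentIn G T u := by
  rw [mem_componentIn] at ha ⊢
  exact ⟨hb, ha.2.trans ((spanningCoe_induce_adj G).2 ⟨ha.1, hb, h⟩).reachable⟩

theorem componentIn_induction {T : Finset V} {u w : V} {P : V → Prop}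
    (hw : w ∈ componentIn G T u) (base : P u)
    (step : ∀ a b, P a → a ∈ T → b ∈ T → G.Adj a b → P b) : P w := by
  refine reachable_induction ((mem_componentIn G).1 hw).2 base fun a b ha hab => ?_
  rw [spanningCoe_induce_adj] at hab
  exact step a b ha hab.1 hab.2.1 hab.2.2

theorem componentIn_subset_of_closed {T K : Finset V} {u : V} (hu : u ∈ K)
    (hK : ∀ a ∈ K, ∀ b ∈ T, G.Adj a b → b ∈ K) : componentIn G T u ⊆ K :=
  fun _ hw => componentIn_induction G hw hu fun a b ha _ hb hab => hK a ha b hb hab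

theorem componentIn_mono {S T : Finset V} (hST : S ⊆ T) {u : V} (hu : u ∈ S) :
    componentIn G S u ⊆ componentIn G T u := fun _ hw =>
  componentIn_induction G hw (self_mem_componentIn G (hST hu)) fun _ _ ha _ hb hab =>
    mem_componentIn_of_adj G ha (hST hb) hab

theorem componentIn_union {A B : Finset V} (hAB : ∀ a ∈ A, ∀ b ∈ B, ¬ G.Adj a b) {u : V}
    (hu : u ∈ A) : componentIn G (A ∪ B) u = componentIn G A u := by
  refine Finset.Subset.antisymm (componentIn_subset_of_closed G (self_mem_componentIn G hu) ?_)
    (componentIn_mono G Finset.subset_union_left hu)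
  intro a ha b hb hab
  have haA := componentIn_subset G A u ha
  exact mem_componentIn_of_adj G ha
    ((Finset.mem_union.1 hb).resolve_right fun hbB => hAB a haA b hbB hab) hab

theorem componentIn_univ_of_connected (hG : G.Connected) (u : V) :
    componentIn G Finset.univ u = Finset.univ := by
  refine Finset.eq_univ_of_forall fun w => ?_
  refine reachable_induction (hG.preconnected u w) (self_mem_componentIn G (Finset.mem_univ u)) ?_
  exact fun a b ha hab => mem_componentIn_of_adj G ha (Finset.mem_univ b) hab

theorem componentIn_map {W : Type*} [Fintype W] [LinearOrder W] (H : SimpleGraph W)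
    [DecidableRel H.Adj] (e : V ↪o W) (he : ∀ a b, H.Adj (e a) (e b) ↔ G.Adj a b)
    (T : Finset V) {u : V} (hu : u ∈ T) :
    componentIn H (T.map e.toEmbedding) (e u) = (componentIn G T u).map e.toEmbedding := by
  apply Finset.Subset.antisymm
  · refine componentIn_subset_of_closed H
      (Finset.mem_map_of_mem e.toEmbedding (self_mem_componentIn G hu)) ?_
    simp only [Finset.forall_mem_map]
    intro a ha b hb hab
    exact Finset.mem_map_of_mem _ (mem_componentIn_of_adj G ha hb ((he a b).1 hab))
  · simp only [Finset.subset_iff, Finset.forall_mem_map]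
    intro w hw
    refine componentIn_induction G (P := fun w => e w ∈ componentIn H _ _) hw ?_ ?_
    · exact self_mem_componentIn H (Finset.mem_map_of_mem e.toEmbedding hu)
    · intro a b ha _ hb hab
      exact mem_componentIn_of_adj H ha (Finset.mem_map_of_mem e.toEmbedding hb) ((he a b).2 hab)

theorem componentwiseOrder_empty : componentwiseOrder G ∅ = [] := by
  rw [componentwiseOrder, dif_neg Finset.not_nonempty_empty]

theorem componentwiseOrder_of_isLeast {T : Finset V} {u : V} (hu : IsLeast (T : Set V) u) :
    componentwiseOrder G T = u :: (componentwiseOrder G ((componentIn G T u).erase u) ++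
      componentwiseOrder G (T \ componentIn G T u)) := by
  have hT : T.Nonempty := ⟨u, hu.1⟩
  rw [componentwiseOrder, dif_pos hT, (T.isLeast_min' hT).unique hu]

theorem componentwiseOrder_of_connected (hG : G.Connected) {u : V} (hu : ∀ w, u ≤ w) :
    componentwiseOrder G Finset.univ = u :: componentwiseOrder G (Finset.univ.erase u) := by
  rw [componentwiseOrder_of_isLeast G (u := u) ⟨by simp, fun w _ => hu w⟩,
    componentIn_univ_of_connected G hG, sdiff_self, Finset.bot_eq_empty,
    componentwiseOrder_empty, List.append_nil]

theorem componentwiseOrder_union {A B : Finset V} {u : V}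
    (hu : IsLeast ((A ∪ B : Finset V) : Set V) u) (hA : componentIn G A u = A) (huA : u ∈ A)
    (hAB : ∀ a ∈ A, ∀ b ∈ B, ¬ G.Adj a b) (hdisj : Disjoint A B) :
    componentwiseOrder G (A ∪ B) = componentwiseOrder G A ++ componentwiseOrder G B := by
  have hu' : IsLeast (A : Set V) u := ⟨huA, fun w hw => hu.2 (by simp [Finset.mem_coe.1 hw])⟩
  rw [componentwiseOrder_of_isLeast G hu, componentwiseOrder_of_isLeast G hu',
    componentIn_union G hAB huA, hA, Finset.union_sdiff_cancel_left hdisj, sdiff_self,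
    Finset.bot_eq_empty, componentwiseOrder_empty, List.append_nil, List.cons_append]

theorem componentwiseOrder_induction {P : Finset V → Prop} (empty : P ∅)
    (step : ∀ (T : Finset V) (u : V), IsLeast (T : Set V) u → P ((componentIn G T u).erase u) →
      P (T \ componentIn G T u) → P T) (T : Finset V) : P T := by
  induction T using Finset.strongInduction with
  | H T ih =>
    rcases T.eq_empty_or_nonempty with rfl | hT
    · exact empty
    · have hu := self_mem_componentIn G (T.min'_mem hT)
      refine step T _ (T.isLeast_min' hT) (ih _ ?_) (ih _ ?_)
      · exact (Finset.erase_ssubset hu).trans_subset (componentIn_subset G _ _)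
      · exact Finset.sdiff_ssubset (componentIn_subset G _ _) ⟨_, hu⟩

theorem mem_componentwiseOrder {T : Finset V} {w : V} : w ∈ componentwiseOrder G T ↔ w ∈ T := by
  induction T using componentwiseOrder_induction G with
  | empty => simp [componentwiseOrder_empty]
  | step T u hu ih₁ ih₂ =>
    rw [componentwiseOrder_of_isLeast G hu, List.mem_cons, List.mem_append, ih₁, ih₂,
      Finset.mem_erase, Finset.mem_sdiff]
    have := self_mem_componentIn G hu.1
    have := @componentIn_subset _ _ _ G _ T u w
    grind

theorem nodup_componentwiseOrder (T : Finset V) : (componentwiseOrder G T).Nodup := by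
  induction T using componentwiseOrder_induction G with
  | empty => simp [componentwiseOrder_empty]
  | step T u hu ih₁ ih₂ =>
    have := self_mem_componentIn G hu.1
    rw [componentwiseOrder_of_isLeast G hu]
    simp only [List.nodup_cons, List.nodup_append, List.mem_append, mem_componentwiseOrder,
      Finset.mem_erase, Finset.mem_sdiff]
    grind

theorem componentwiseOrder_map {W : Type*} [Fintype W] [LinearOrder W] (H : SimpleGraph W)
    [DecidableRel H.Adj] (e : V ↪o W) (he : ∀ a b, H.Adj (e a) (e b) ↔ G.Adj a b)
    (T : Finset V) :
    componentwiseOrder H (T.map e.toEmbedding) = (componentwiseOrder G T).map e := by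
  induction T using componentwiseOrder_induction G with
  | empty => simp [componentwiseOrder_empty]
  | step T u hu ih₁ ih₂ =>
    have hu' : IsLeast ((T.map e.toEmbedding : Finset W) : Set W) (e u) := by
      simpa using e.monotone.map_isLeast hu
    have herase : ((componentIn G T u).map e.toEmbedding).erase (e u) =
        ((componentIn G T u).erase u).map e.toEmbedding := (Finset.map_erase _ _ _).symm
    rw [componentwiseOrder_of_isLeast G hu, componentwiseOrder_of_isLeast H hu',
      componentIn_map G H e he T hu.1, ← Finset.map_sdiff, herase, ih₁, ih₂,
      List.map_cons, List.map_append]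

theorem lt_of_adj_of_getLast?_componentwiseOrder {T : Finset V} {c d : V}
    (hc : (componentwiseOrder G T).getLast? = some c) (hd : d ∈ T) (hcd : G.Adj c d) : d < c := by
  induction T using componentwiseOrder_induction G with
  | empty => simp at hd
  | step T u hu ih₁ ih₂ =>
    rw [componentwiseOrder_of_isLeast G hu, List.getLast?_cons, List.getLast?_append] at hc
    cases hB : (componentwiseOrder G (T \ componentIn G T u)).getLast? with
    | some c' =>
      obtain rfl : c' = c := by simpa [hB] using hc
      have hcB := (mem_componentwiseOrder G).1 (List.mem_of_getLast? hB)
      refine ih₂ hB (Finset.mem_sdiff.2 ⟨hd, fun hdK => ?_⟩)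
      rw [Finset.mem_sdiff] at hcB
      exact hcB.2 (mem_componentIn_of_adj G hdK hcB.1 hcd.symm)
    | none =>
      have hdK : d ∈ componentIn G T u := by
        rw [List.getLast?_eq_none_iff] at hB
        by_contra h
        simpa [hB] using (mem_componentwiseOrder G).2 (Finset.mem_sdiff.2 ⟨hd, h⟩)
      cases hA : (componentwiseOrder G ((componentIn G T u).erase u)).getLast? with
      | some c' =>
        obtain rfl : c' = c := by simpa [hA, hB] using hc
        have hcA := (mem_componentwiseOrder G).1 (List.mem_of_getLast? hA)
        rw [Finset.mem_erase] at hcA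
        rcases eq_or_ne d u with rfl | hdu
        · exact (hu.2 (componentIn_subset G _ _ hcA.2)).lt_of_ne hcA.1.symm
        · exact ih₁ hA (Finset.mem_erase.2 ⟨hdu, hdK⟩)
      | none =>
        obtain rfl : u = c := by simpa [hA, hB] using hc
        rw [List.getLast?_eq_none_iff] at hA
        simpa [hA] using (mem_componentwiseOrder G).2 (Finset.mem_erase.2 ⟨hcd.ne', hdK⟩)

end Order

section Words

theorem map_filter_idxOf_add {α : Type*} [BEq α] [LawfulBEq α] (p : α → Bool) {l : List α}
    (hl : l.Nodup) (s : ℕ) :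
    (l.filter p).map (fun c => l.idxOf c + s) = l.findIdxs p s := by
  induction l generalizing s with
  | nil => rfl
  | cons a l ih =>
    rw [List.nodup_cons] at hl
    have htail : (l.filter p).map (fun c => (a :: l).idxOf c + s) = l.findIdxs p (s + 1) := by
      rw [← ih hl.2]
      refine List.map_congr_left fun c hc => ?_
      have hac : a ≠ c := fun h => hl.1 (h ▸ List.mem_of_mem_filter hc)
      rw [List.idxOf_cons_ne _ hac]
      omega
    rw [List.filter_cons, List.findIdxs_cons, ← htail]
    by_cases hp : p a <;> simp [hp]

theorem exists_idxsOf_eq_cons {w : List Bool} (hw : true ∈ w) (s : ℕ) :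
    ∃ l, w.idxsOf true s = (w.idxOf true + s) :: l := by
  have hlen : 0 < (w.idxsOf true s).length := by
    rw [List.length_idxsOf]
    exact List.count_pos_iff.2 hw
  obtain ⟨x, l, hl⟩ := List.exists_cons_of_length_pos hlen
  have hx := List.getElem_zero_idxsOf_eq_idxOf_add hlen
  simp only [hl, List.getElem_cons_zero] at hx
  exact ⟨l, hx ▸ hl⟩

/-- The differences of consecutive entries of a list. Subtraction is truncated, which does not
matter for the increasing lists to which this is applied. -/
def differences (l : List ℕ) : List ℕ := List.zipWith (fun s t => t - s) l l.tail

theorem length_differences (l : List ℕ) : (differences l).length = l.length - 1 := by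
  simp [differences]

theorem differences_map_add (l : List ℕ) (a : ℕ) :
    differences (l.map (· + a)) = differences l := by
  simp [differences, ← List.map_tail, List.zipWith_map,
    Nat.add_sub_add_right]

theorem differences_idxsOf (w : List Bool) (s t : ℕ) :
    differences (w.idxsOf true s) = differences (w.idxsOf true t) := by
  rw [List.idxsOf_start (s := s), List.idxsOf_start (s := t), differences_map_add,
    differences_map_add]

theorem differences_append (l : List ℕ) (x y : ℕ) (m : List ℕ) :
    differences (l ++ x :: y :: m) =
      differences (l ++ [x]) ++ (y - x) :: differences (y :: m) := by
  induction l with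
  | nil => simp [differences]
  | cons z l ih =>
    cases l with
    | nil => simp [differences]
    | cons => simpa [differences] using ih

variable {A : Type*} [CommSemiring A] (f : ℕ → A)

/-- The monomial of a word that marks the terminal chords of a diagram, listed in the intersection
order, by `true`: a factor `f 0` for each nonterminal chord, and a factor `f δ` for each distance
`δ` between consecutive terminal chords. -/
def wordMonomial (w : List Bool) : A :=
  f 0 ^ w.count false * ((differences (w.idxsOf true 1)).map f).prod

theorem wordMonomial_singleton_true : wordMonomial f [true] = 1 := by
  simp [wordMonomial, differences]

theorem wordMonomial_false_cons (w : List Bool) :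
    wordMonomial f (false :: w) = f 0 * wordMonomial f w := by
  have hpos : (false :: w).idxsOf true 1 = w.idxsOf true 2 := by simp
  rw [wordMonomial, wordMonomial, hpos, differences_idxsOf w 2 1, List.count_cons_self, pow_succ',
    mul_assoc]

theorem wordMonomial_append (u : List Bool) {v : List Bool} (hv : true ∈ v) :
    wordMonomial f (u ++ true :: v) =
      wordMonomial f (u ++ [true]) * f (v.idxOf true + 1) * wordMonomial f v := by
  obtain ⟨l, hl⟩ := exists_idxsOf_eq_cons hv (1 + u.length + 1)
  have hdiff : differences ((u ++ true :: v).idxsOf true 1) =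
      differences ((u ++ [true]).idxsOf true 1) ++
        (v.idxOf true + 1) :: differences (v.idxsOf true 1) := by
    rw [differences_idxsOf v 1 (1 + u.length + 1)]
    simp only [List.idxsOf_append, List.idxsOf_cons, hl, beq_self_eq_true, if_true,
      List.idxsOf_nil, differences_append]
    congr 2
    omega
  simp only [wordMonomial, hdiff, List.map_append, List.map_cons, List.prod_append,
    List.prod_cons, List.count_append, List.count_cons, List.count_nil, pow_add]
  ring

end Words

namespace RootedChordDiagram

variable {n : ℕ} (C : RootedChordDiagram n)

theorem partner_partner (x : Fin (2 * n)) : C.1 (C.1 x) = x := C.2.1 x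

theorem partner_ne (x : Fin (2 * n)) : C.1 x ≠ x := C.2.2 x

theorem partner_injective : Function.Injective C.1 :=
  Function.Involutive.injective C.partner_partner

theorem edge_iff_adj_and_lt {c d : C.Chord} :
    C.Edge c d ↔ C.intersectionGraph.Adj c d ∧ c < d :=
  ⟨fun h => ⟨Or.inl h, h.1⟩, fun ⟨h, hlt⟩ => h.resolve_right fun h' => hlt.not_gt h'.1⟩

/-- The chord through a given point. -/
def chordAt (y : Fin (2 * n)) : C.Chord :=
  ⟨min y (C.1 y), by
    have := C.partner_ne y
    have := C.partner_partner y
    grind⟩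

theorem chordAt_eq_iff {y : Fin (2 * n)} {c : C.Chord} :
    C.chordAt y = c ↔ y = c.1 ∨ y = C.1 c.1 := by
  have := C.partner_partner y
  have := C.partner_partner c.1
  have := c.2
  rw [Subtype.ext_iff, chordAt]
  grind

theorem chordAt_fst (c : C.Chord) : C.chordAt c.1 = c := C.chordAt_eq_iff.2 (Or.inl rfl)

theorem chordAt_partner (y : Fin (2 * n)) : C.chordAt (C.1 y) = C.chordAt y := by
  rw [chordAt_eq_iff]
  rcases C.chordAt_eq_iff.1 (rfl : C.chordAt y = _) with h | h
  · exact Or.inr (congrArg C.1 h)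
  · exact Or.inl (by rw [h, partner_partner, ← h])

open Finset in
theorem card_filter_chordAt_mem (S : Finset C.Chord) : #{y | C.chordAt y ∈ S} = 2 * #S := by
  have hfiber : ∀ c ∈ S, #{y ∈ ({y | C.chordAt y ∈ S} : Finset _) | C.chordAt y = c} = 2 := by
    intro c hc
    refine Eq.trans (congrArg card ?_) (card_pair c.2.ne)
    ext y
    rw [mem_filter, mem_filter_univ, mem_insert, mem_singleton, ← chordAt_eq_iff]
    exact and_iff_right_of_imp fun h => h ▸ hc
  rw [card_eq_sum_card_fiberwise (f := C.chordAt) (t := S) fun y hy => by simpa using hy,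
    sum_congr rfl hfiber, sum_const, smul_eq_mul, mul_comm]

theorem card_chord : Fintype.card C.Chord = n := by
  have h := C.card_filter_chordAt_mem Finset.univ
  simp only [Finset.mem_univ, Finset.filter_true, Finset.card_univ, Fintype.card_fin] at h
  omega

/-- The chord through the first point. -/
def root (hn : 0 < n) : C.Chord :=
  ⟨⟨0, by omega⟩, (Fin.le_def.2 (Nat.zero_le _)).lt_of_ne (C.partner_ne _).symm⟩

theorem root_fst (hn : 0 < n) : ((C.root hn).1 : ℕ) = 0 := rfl

theorem root_le (hn : 0 < n) (c : C.Chord) : C.root hn ≤ c := Fin.le_def.2 (Nat.zero_le _)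

theorem pos_of_connected {C : RootedChordDiagram n} (hC : C.Connected) : 0 < n := by
  obtain ⟨c⟩ := hC.nonempty
  have := c.1.2
  omega

theorem connected_iff (hn : 0 < n) :
    C.Connected ↔ ∀ c, C.intersectionGraph.Reachable (C.root hn) c := by
  refine ⟨fun h c => h.preconnected _ c, fun h => ?_⟩
  exact (SimpleGraph.connected_iff_exists_forall_reachable _).2 ⟨_, h⟩

theorem exists_chord_straddling {C : RootedChordDiagram n} (hC : C.Connected) {g : ℕ}
    (hg : g + 1 < 2 * n) : ∃ c : C.Chord, (c.1 : ℕ) ≤ g ∧ g < C.1 c.1 := by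
  by_contra! hright
  have hleft (c : C.Chord) : (c.1 : ℕ) ≤ g := by
    refine reachable_induction (P := fun c : C.Chord => (c.1 : ℕ) ≤ g)
      (hC.preconnected (C.root (by omega)) c) (Nat.zero_le g) ?_
    rintro a b ha (h | h)
    · exact (Fin.lt_def.1 h.2.1).le.trans (hright a ha)
    · exact (Fin.lt_def.1 h.1).le.trans ha
  have hle₁ := hleft (C.chordAt ⟨g + 1, hg⟩)
  have hle₂ := hright _ hle₁
  rcases C.chordAt_eq_iff.1 (rfl : C.chordAt ⟨g + 1, hg⟩ = _) with h | h
  · exact absurd hle₁ (by simp [← h])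
  · exact absurd hle₂ (by simp [← h])

theorem mem_intersectionOrder (c : C.Chord) : c ∈ C.intersectionOrder := by
  simp [intersectionOrder, mem_componentwiseOrder]

theorem nodup_intersectionOrder : C.intersectionOrder.Nodup := nodup_componentwiseOrder _ _

theorem length_intersectionOrder : C.intersectionOrder.length = n := by
  have huniv : C.intersectionOrder.toFinset = Finset.univ :=
    Finset.eq_univ_of_forall fun c => List.mem_toFinset.2 (C.mem_intersectionOrder c)
  refine Eq.trans ?_ C.card_chord
  rw [← List.toFinset_card_of_nodup C.nodup_intersectionOrder, huniv, Finset.card_univ]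

theorem intersectionOrder_of_connected {C : RootedChordDiagram n} (hC : C.Connected) (hn : 0 < n) :
    C.intersectionOrder = C.root hn ::
      componentwiseOrder C.intersectionGraph (Finset.univ.erase (C.root hn)) :=
  componentwiseOrder_of_connected _ hC (C.root_le hn)

/-- The word that marks the terminal chords along the intersection order. -/
def word : List Bool := C.intersectionOrder.map (C.IsTerminal ·)

theorem length_word : C.word.length = n := by
  rw [word, List.length_map, length_intersectionOrder]

theorem getLast?_word (hn : 0 < n) : C.word.getLast? = some true := by
  have hne : C.intersectionOrder ≠ [] := List.ne_nil_of_mem (C.mem_intersectionOrder (C.root hn))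
  have hlast := List.getLast?_eq_some_getLast hne
  have hterminal : C.IsTerminal (C.intersectionOrder.getLast hne) := fun d hd => by
    rw [edge_iff_adj_and_lt] at hd
    exact hd.2.not_gt
      (lt_of_adj_of_getLast?_componentwiseOrder _ hlast (Finset.mem_univ d) hd.1)
  rw [word, List.getLast?_map, hlast, Option.map_some, decide_eq_true hterminal]

theorem true_mem_word (hn : 0 < n) : true ∈ C.word := List.mem_of_getLast? (C.getLast?_word hn)

theorem terminalLabels_eq_idxsOf : C.terminalLabels = C.word.idxsOf true 1 := by
  have h := map_filter_idxOf_add (C.IsTerminal ·) C.nodup_intersectionOrder 1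
  rw [word, List.idxsOf_map]
  simp only [beq_true]
  exact h

theorem b_eq_idxOf_add_one (hn : 0 < n) : C.b = C.word.idxOf true + 1 := by
  obtain ⟨l, hl⟩ := exists_idxsOf_eq_cons (C.true_mem_word hn) 1
  rw [b, terminalLabels_eq_idxsOf, hl, List.headD_cons]

theorem b_pos (hn : 0 < n) : 0 < C.b := by
  rw [b_eq_idxOf_add_one _ hn]
  exact Nat.succ_pos _

theorem monomial_eq_wordMonomial {A : Type*} [CommSemiring A] (f : ℕ → A) (hn : 0 < n) :
    C.monomial f = wordMonomial f C.word := by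
  have hgaps : C.gaps = differences (C.word.idxsOf true 1) := by
    rw [← terminalLabels_eq_idxsOf]
    rfl
  have hcount : n - C.gaps.length - 1 = C.word.count false := by
    have hlen := C.word.count_add_count_not true
    have hpos := List.count_pos_iff.2 (C.true_mem_word hn)
    rw [hgaps, length_differences, List.length_idxsOf]
    rw [length_word, Bool.not_true] at hlen
    omega
  rw [monomial, wordMonomial, hcount, hgaps]

variable {C}

theorem word_eq_singleton_true (hn : n = 1) : C.word = [true] := by
  obtain ⟨a, ha⟩ := List.length_eq_one_iff.1 (C.length_word.trans hn)
  have hlast := C.getLast?_word (by omega)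
  rw [ha, List.getLast?_singleton, Option.some.injEq] at hlast
  rw [ha, hlast]

theorem b_eq_one (hn : n = 1) : C.b = 1 := by
  rw [b_eq_idxOf_add_one C (by omega), word_eq_singleton_true hn, List.idxOf_cons_self]

theorem exists_edge_root (hC : C.Connected) (hn : 1 < n) :
    ∃ c, C.Edge (C.root (pos_of_connected hC)) c := by
  have : Nontrivial C.Chord := Fintype.one_lt_card_iff_nontrivial.1 (by rwa [C.card_chord])
  obtain ⟨c, hc⟩ := hC.preconnected.exists_adj_of_nontrivial (C.root (pos_of_connected hC))
  exact ⟨c, C.edge_iff_adj_and_lt.2 ⟨hc, (C.root_le _ c).lt_of_ne hc.ne⟩⟩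

theorem exists_word_eq_false_cons (hC : C.Connected) (hn : 1 < n) :
    ∃ v, true ∈ v ∧ C.word = false :: v := by
  obtain ⟨c, hc⟩ := exists_edge_root hC hn
  have hroot : ¬ C.IsTerminal (C.root _) := fun h => h c hc
  have hword : ∃ v, C.word = false :: v := by
    rw [word, intersectionOrder_of_connected hC (pos_of_connected hC), List.map_cons,
      decide_eq_false hroot]
    exact ⟨_, rfl⟩
  obtain ⟨v, hv⟩ := hword
  have htrue := C.true_mem_word (pos_of_connected hC)
  exact ⟨v, by simpa [hv] using htrue, hv⟩

end RootedChordDiagram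

/-- The data for inserting a diagram with `m` chords into one with `k` chords. The points
`0, …, gap` of the former are put directly after the root of the latter, and all of its other
points at the end, so that every point of the latter but the root ends up in the gap. -/
structure InsertionShape (k m n : ℕ) where
  gap : ℕ
  pos : 0 < k
  gap_lt : gap + 1 < 2 * m
  add_eq : k + m = n

namespace InsertionShape

open RootedChordDiagram

variable {k m n : ℕ}

theorem pos_total (s : InsertionShape k m n) : 0 < n := by
  have := s.pos
  have := s.add_eq
  omega

variable (s : InsertionShape k m n)

/-- The new position of a point of the diagram with `k` chords. -/
def outer (x : Fin (2 * k)) : Fin (2 * n) :=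
  ⟨if (x : ℕ) = 0 then 0 else (x : ℕ) + (s.gap + 1), by
    have := s.gap_lt
    have := s.add_eq
    grind⟩

/-- The new position of a point of the diagram with `m` chords. -/
def inner (x : Fin (2 * m)) : Fin (2 * n) :=
  ⟨if (x : ℕ) ≤ s.gap then (x : ℕ) + 1 else x + 2 * k, by
    have := s.pos
    have := s.add_eq
    grind⟩

theorem outer_val (x : Fin (2 * k)) :
    (s.outer x : ℕ) = if (x : ℕ) = 0 then 0 else (x : ℕ) + (s.gap + 1) := rfl

theorem inner_val (x : Fin (2 * m)) :
    (s.inner x : ℕ) = if (x : ℕ) ≤ s.gap then (x : ℕ) + 1 else x + 2 * k := rfl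

theorem outer_strictMono : StrictMono s.outer := fun x y h => by
  rw [Fin.lt_def] at h ⊢
  rw [outer_val, outer_val]
  split_ifs <;> omega

theorem inner_strictMono : StrictMono s.inner := fun x y h => by
  have := s.pos
  rw [Fin.lt_def] at h ⊢
  rw [inner_val, inner_val]
  split_ifs <;> omega

theorem outer_ne_inner (x : Fin (2 * k)) (y : Fin (2 * m)) : s.outer x ≠ s.inner y := by
  rw [Fin.ne_iff_vne, outer_val, inner_val]
  split_ifs <;> omega

theorem inner_lt_outer_iff {x : Fin (2 * k)} (hx : (x : ℕ) ≠ 0) (y : Fin (2 * m)) :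
    s.inner y < s.outer x ↔ (y : ℕ) ≤ s.gap := by
  rw [Fin.lt_def, inner_val, outer_val]
  split_ifs <;> omega

theorem outer_lt_inner_iff {x : Fin (2 * k)} (hx : (x : ℕ) ≠ 0) (y : Fin (2 * m)) :
    s.outer x < s.inner y ↔ s.gap < y := by
  rw [Fin.lt_def, inner_val, outer_val]
  split_ifs <;> omega

theorem mem_range_inner_iff (y : Fin (2 * n)) :
    y ∈ Set.range s.inner ↔ 1 ≤ (y : ℕ) ∧ (y : ℕ) ≤ s.gap + 1 ∨ s.gap + 1 + 2 * k ≤ y := by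
  have := s.pos
  have := s.gap_lt
  have := s.add_eq
  simp only [Set.mem_range, Fin.ext_iff, inner_val]
  constructor
  · rintro ⟨x, hx⟩
    split_ifs at hx <;> omega
  · rintro (h | h)
    · exact ⟨⟨y - 1, by omega⟩, by grind⟩
    · exact ⟨⟨y - 2 * k, by omega⟩, by grind⟩

theorem eq_of_range_inner_eq {k' m' : ℕ} {s' : InsertionShape k' m' n}
    (h : Set.range s.inner = Set.range s'.inner) : k = k' ∧ m = m' ∧ s.gap = s'.gap := by
  have hiff (y : ℕ) (hy : y < 2 * n) : (1 ≤ y ∧ y ≤ s.gap + 1 ∨ s.gap + 1 + 2 * k ≤ y) ↔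
      (1 ≤ y ∧ y ≤ s'.gap + 1 ∨ s'.gap + 1 + 2 * k' ≤ y) := by
    rw [← s.mem_range_inner_iff ⟨y, hy⟩, h, s'.mem_range_inner_iff ⟨y, hy⟩]
  have h₁ := hiff (s.gap + 2)
  have h₂ := hiff (s'.gap + 2)
  have h₃ := hiff (s.gap + 1 + 2 * k)
  have h₄ := hiff (s'.gap + 1 + 2 * k')
  obtain ⟨_, _, _, _⟩ := s
  obtain ⟨_, _, _, _⟩ := s'
  dsimp only at *
  omega

/-- The points of the diagram obtained by insertion are those of the two given diagrams. -/
noncomputable def pointEquiv : Fin (2 * k) ⊕ Fin (2 * m) ≃ Fin (2 * n) :=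
  Equiv.ofBijective (Sum.elim s.outer s.inner) <| by
    rw [Fintype.bijective_iff_injective_and_card]
    refine ⟨s.outer_strictMono.injective.sumElim s.inner_strictMono.injective s.outer_ne_inner, ?_⟩
    simp [← s.add_eq, mul_add]

theorem forall_point {P : Fin (2 * n) → Prop} :
    (∀ y, P y) ↔ (∀ x, P (s.outer x)) ∧ ∀ x, P (s.inner x) := by
  rw [← s.pointEquiv.forall_congr_right, Sum.forall]
  rfl

/-- The diagram obtained by inserting `D` into `R`. -/
noncomputable def insert (R : RootedChordDiagram k) (D : RootedChordDiagram m) :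
    RootedChordDiagram n :=
  ⟨s.pointEquiv ∘ Sum.map R.1 D.1 ∘ s.pointEquiv.symm, by
    simp [← s.pointEquiv.forall_congr_right, partner_partner, partner_ne]⟩

variable (R : RootedChordDiagram k) (D : RootedChordDiagram m)

theorem insert_outer (x : Fin (2 * k)) : (s.insert R D).1 (s.outer x) = s.outer (R.1 x) :=
  congrArg (s.pointEquiv ∘ Sum.map R.1 D.1) (s.pointEquiv.symm_apply_apply (Sum.inl x))

theorem insert_inner (x : Fin (2 * m)) : (s.insert R D).1 (s.inner x) = s.inner (D.1 x) :=
  congrArg (s.pointEquiv ∘ Sum.map R.1 D.1) (s.pointEquiv.symm_apply_apply (Sum.inr x))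

theorem eq_insert_iff {C : RootedChordDiagram n} : C = s.insert R D ↔
    (∀ x, C.1 (s.outer x) = s.outer (R.1 x)) ∧ ∀ x, C.1 (s.inner x) = s.inner (D.1 x) := by
  refine Subtype.ext_iff.trans (funext_iff.trans (s.forall_point.trans ?_))
  simp only [insert_outer, insert_inner]

theorem insert_injective {R R' : RootedChordDiagram k} {D D' : RootedChordDiagram m}
    (h : s.insert R D = s.insert R' D') : R = R' ∧ D = D' := by
  obtain ⟨hR, hD⟩ := (s.eq_insert_iff R' D').1 h
  simp only [insert_outer, insert_inner, s.outer_strictMono.injective.eq_iff,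
    s.inner_strictMono.injective.eq_iff] at hR hD
  exact ⟨Subtype.ext (funext hR), Subtype.ext (funext hD)⟩

/-- The chords of `R` as chords of the diagram obtained by inserting `D` into `R`. -/
noncomputable def outerChord : R.Chord ↪o (s.insert R D).Chord :=
  OrderEmbedding.ofStrictMono
    (fun c => ⟨s.outer c.1, by rw [insert_outer]; exact s.outer_strictMono c.2⟩)
    fun _ _ h => s.outer_strictMono h

/-- The chords of `D` as chords of the diagram obtained by inserting `D` into `R`. -/
noncomputable def innerChord : D.Chord ↪o (s.insert R D).Chord :=
  OrderEmbedding.ofStrictMono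
    (fun c => ⟨s.inner c.1, by rw [insert_inner]; exact s.inner_strictMono c.2⟩)
    fun _ _ h => s.inner_strictMono h

theorem outerChord_fst (c : R.Chord) : (s.outerChord R D c).1 = s.outer c.1 := rfl

theorem innerChord_fst (c : D.Chord) : (s.innerChord R D c).1 = s.inner c.1 := rfl

theorem chordAt_outer (x : Fin (2 * k)) :
    (s.insert R D).chordAt (s.outer x) = s.outerChord R D (R.chordAt x) := by
  rw [chordAt_eq_iff, outerChord_fst, insert_outer, s.outer_strictMono.injective.eq_iff,
    s.outer_strictMono.injective.eq_iff, ← chordAt_eq_iff]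

theorem chordAt_inner (x : Fin (2 * m)) :
    (s.insert R D).chordAt (s.inner x) = s.innerChord R D (D.chordAt x) := by
  rw [chordAt_eq_iff, innerChord_fst, insert_inner, s.inner_strictMono.injective.eq_iff,
    s.inner_strictMono.injective.eq_iff, ← chordAt_eq_iff]

theorem forall_chord {P : (s.insert R D).Chord → Prop} :
    (∀ c, P c) ↔ (∀ r, P (s.outerChord R D r)) ∧ ∀ d, P (s.innerChord R D d) := by
  refine ⟨fun h => ⟨fun r => h _, fun d => h _⟩, fun ⟨hR, hD⟩ c => ?_⟩
  have hpoint := (s.forall_point (P := fun y => P ((s.insert R D).chordAt y))).2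
    ⟨fun x => s.chordAt_outer R D x ▸ hR _, fun x => s.chordAt_inner R D x ▸ hD _⟩
  exact chordAt_fst _ c ▸ hpoint c.1

theorem outerChord_ne_innerChord (r : R.Chord) (d : D.Chord) :
    s.outerChord R D r ≠ s.innerChord R D d := fun h =>
  s.outer_ne_inner r.1 d.1 (congrArg Subtype.val h)

theorem outerChord_root (hk : 0 < k) (hn : 0 < n) :
    s.outerChord R D (R.root hk) = (s.insert R D).root hn := Subtype.ext (Fin.ext rfl)

theorem edge_outerChord (a b : R.Chord) :
    (s.insert R D).Edge (s.outerChord R D a) (s.outerChord R D b) ↔ R.Edge a b := by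
  simp only [Edge, outerChord_fst, insert_outer, s.outer_strictMono.lt_iff_lt]

theorem edge_innerChord (a b : D.Chord) :
    (s.insert R D).Edge (s.innerChord R D a) (s.innerChord R D b) ↔ D.Edge a b := by
  simp only [Edge, innerChord_fst, insert_inner, s.inner_strictMono.lt_iff_lt]

theorem adj_outerChord (a b : R.Chord) :
    (s.insert R D).intersectionGraph.Adj (s.outerChord R D a) (s.outerChord R D b) ↔
      R.intersectionGraph.Adj a b :=
  or_congr (s.edge_outerChord R D a b) (s.edge_outerChord R D b a)

theorem adj_innerChord (a b : D.Chord) :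
    (s.insert R D).intersectionGraph.Adj (s.innerChord R D a) (s.innerChord R D b) ↔
      D.intersectionGraph.Adj a b :=
  or_congr (s.edge_innerChord R D a b) (s.edge_innerChord R D b a)

variable {R D}

theorem eq_root_of_adj {r : R.Chord} {d : D.Chord}
    (h : (s.insert R D).intersectionGraph.Adj (s.outerChord R D r) (s.innerChord R D d)) :
    r = R.root s.pos := by
  by_contra hr
  have h₁ : (r.1 : ℕ) ≠ 0 := fun h => hr (Subtype.ext (Fin.ext h))
  have h₂ : (R.1 r.1 : ℕ) ≠ 0 := Nat.ne_zero_of_lt r.2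
  rcases h with h | h <;>
  · simp only [Edge, outerChord_fst, innerChord_fst, insert_outer, insert_inner,
      s.outer_lt_inner_iff h₁, s.outer_lt_inner_iff h₂, s.inner_lt_outer_iff h₁,
      s.inner_lt_outer_iff h₂] at h
    omega

theorem not_edge_innerChord_outerChord (r : R.Chord) (d : D.Chord) :
    ¬ (s.insert R D).Edge (s.innerChord R D d) (s.outerChord R D r) := fun h => by
  have hroot := s.eq_root_of_adj (Or.inr h)
  rw [hroot, outerChord_root _ _ _ _ s.pos_total] at h
  exact (root_le _ _ _).not_gt h.1

theorem exists_edge_root_innerChord (hD : D.Connected) (hn : 0 < n) :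
    ∃ d, (s.insert R D).Edge ((s.insert R D).root hn) (s.innerChord R D d) := by
  obtain ⟨d, hd₁, hd₂⟩ := exists_chord_straddling hD s.gap_lt
  have hend : (R.1 (R.root s.pos).1 : ℕ) ≠ 0 := Nat.ne_zero_of_lt (R.root s.pos).2
  have hfst : s.outer (R.root s.pos).1 < s.inner d.1 := by
    rw [Fin.lt_def, outer_val, inner_val, root_fst, if_pos rfl, if_pos hd₁]
    omega
  refine ⟨d, ?_⟩
  rw [← s.outerChord_root R D s.pos hn, Edge, outerChord_fst, innerChord_fst, insert_outer,
    insert_inner, s.inner_lt_outer_iff hend, s.outer_lt_inner_iff hend]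
  exact ⟨hfst, hd₁, hd₂⟩

theorem insert_connected (hR : R.Connected) (hD : D.Connected) : (s.insert R D).Connected := by
  have hn := s.pos_total
  obtain ⟨d₀, hd₀⟩ := s.exists_edge_root_innerChord (R := R) hD hn
  rw [connected_iff _ hn, s.forall_chord]
  constructor
  · intro r
    rw [← s.outerChord_root R D s.pos hn]
    let φ : R.intersectionGraph →g (s.insert R D).intersectionGraph :=
      ⟨s.outerChord R D, (s.adj_outerChord R D _ _).2⟩
    exact (hR.preconnected _ r).map φ
  · intro d
    let φ : D.intersectionGraph →g (s.insert R D).intersectionGraph :=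
      ⟨s.innerChord R D, (s.adj_innerChord R D _ _).2⟩
    exact (SimpleGraph.Adj.reachable (Or.inl hd₀)).trans ((hD.preconnected d₀ d).map φ)

variable (R)

theorem erase_root_eq_union (hn : 0 < n) :
    (Finset.univ.erase ((s.insert R D).root hn)) =
      Finset.univ.map (s.innerChord R D).toEmbedding ∪
        (Finset.univ.erase (R.root s.pos)).map (s.outerChord R D).toEmbedding := by
  rw [← s.outerChord_root R D s.pos hn, Finset.ext_iff, s.forall_chord]
  simp [outerChord_ne_innerChord, (outerChord_ne_innerChord _ _ _ _ _).symm]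

theorem not_adj_of_mem_inner_of_mem_outer :
    ∀ a ∈ Finset.univ.map (s.innerChord R D).toEmbedding,
      ∀ b ∈ (Finset.univ.erase (R.root s.pos)).map (s.outerChord R D).toEmbedding,
        ¬ (s.insert R D).intersectionGraph.Adj a b := by
  simp only [Finset.forall_mem_map, Finset.mem_erase]
  exact fun d _ r hr h => hr.1 (s.eq_root_of_adj h.symm)

theorem componentIn_univ_map_innerChord (hD : D.Connected) (d : D.Chord) :
    componentIn (s.insert R D).intersectionGraph (Finset.univ.map (s.innerChord R D).toEmbedding)
      (s.innerChord R D d) = Finset.univ.map (s.innerChord R D).toEmbedding := by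
  refine (componentIn_map D.intersectionGraph _ (s.innerChord R D) (s.adj_innerChord R D) _
    (Finset.mem_univ d)).trans ?_
  rw [componentIn_univ_of_connected _ hD]

theorem innerChord_root_le (hm : 0 < m) {c : (s.insert R D).Chord}
    (hc : c ≠ (s.insert R D).root s.pos_total) : s.innerChord R D (D.root hm) ≤ c := by
  have hpos : (c.1 : ℕ) ≠ 0 := fun h => hc (Subtype.ext (Fin.ext h))
  rw [← Subtype.coe_le_coe, innerChord_fst, Fin.le_def, inner_val, root_fst,
    if_pos (Nat.zero_le _)]
  omega

variable {R}

theorem intersectionOrder_insert (hR : R.Connected) (hD : D.Connected) :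
    (s.insert R D).intersectionOrder = (s.insert R D).root s.pos_total ::
      (D.intersectionOrder.map (s.innerChord R D) ++
        R.intersectionOrder.tail.map (s.outerChord R D)) := by
  have hm := pos_of_connected hD
  let G := (s.insert R D).intersectionGraph
  let A := Finset.univ.map (s.innerChord R D).toEmbedding
  let B := (Finset.univ.erase (R.root s.pos)).map (s.outerChord R D).toEmbedding
  have hunion :
      componentwiseOrder G (A ∪ B) = componentwiseOrder G A ++ componentwiseOrder G B := by
    have hmem : s.innerChord R D (D.root hm) ∈ A := Finset.mem_map_of_mem _ (Finset.mem_univ _)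
    refine componentwiseOrder_union G ⟨Finset.mem_union_left _ hmem, fun c hc => ?_⟩
      (s.componentIn_univ_map_innerChord R hD _) hmem (s.not_adj_of_mem_inner_of_mem_outer R) ?_
    · have hc' := (s.erase_root_eq_union R s.pos_total).symm.subset hc
      exact s.innerChord_root_le R hm (Finset.ne_of_mem_erase hc')
    · refine Finset.disjoint_left.2 (Finset.forall_mem_map.2 fun d _ hd => ?_)
      obtain ⟨r, -, hr⟩ := Finset.mem_map.1 hd
      exact s.outerChord_ne_innerChord R D r d hr
  rw [intersectionOrder_of_connected (s.insert_connected hR hD) s.pos_total,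
    intersectionOrder_of_connected hR s.pos, List.tail_cons, erase_root_eq_union]
  rw [List.cons_inj_right]
  refine hunion.trans (congrArg₂ _ ?_ ?_)
  · exact componentwiseOrder_map D.intersectionGraph _ _ (s.adj_innerChord R D) _
  · exact componentwiseOrder_map R.intersectionGraph _ _ (s.adj_outerChord R D) _

theorem isTerminal_innerChord_iff (d : D.Chord) :
    (s.insert R D).IsTerminal (s.innerChord R D d) ↔ D.IsTerminal d := by
  rw [IsTerminal, s.forall_chord]
  simp only [not_edge_innerChord_outerChord, edge_innerChord, not_false_eq_true, implies_true,
    true_and]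

theorem isTerminal_outerChord_iff {r : R.Chord} (hr : r ≠ R.root s.pos) :
    (s.insert R D).IsTerminal (s.outerChord R D r) ↔ R.IsTerminal r := by
  rw [IsTerminal, s.forall_chord]
  simp only [edge_outerChord, and_iff_left_iff_imp]
  exact fun _ d h => hr (s.eq_root_of_adj (Or.inl h))

theorem word_insert (hR : R.Connected) (hD : D.Connected) :
    (s.insert R D).word = false :: (D.word ++ R.word.tail) := by
  have hroot : ¬ (s.insert R D).IsTerminal ((s.insert R D).root s.pos_total) := fun h =>
    have ⟨_, hd⟩ := s.exists_edge_root_innerChord (R := R) hD s.pos_total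
    h _ hd
  have hnotmem : R.root s.pos ∉ R.intersectionOrder.tail := by
    have hnodup := R.nodup_intersectionOrder
    rw [intersectionOrder_of_connected hR s.pos] at hnodup ⊢
    exact (List.nodup_cons.1 hnodup).1
  rw [word, intersectionOrder_insert s hR hD, List.map_cons, List.map_append, List.map_map,
    List.map_map, decide_eq_false hroot, word, word, ← List.map_tail]
  congr 2
  · exact List.map_congr_left fun d _ => decide_eq_decide.2 (s.isTerminal_innerChord_iff d)
  · refine List.map_congr_left fun r hr => decide_eq_decide.2 (s.isTerminal_outerChord_iff ?_)
    exact ne_of_mem_of_not_mem hr hnotmem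

theorem b_insert (hR : R.Connected) (hD : D.Connected) : (s.insert R D).b = D.b + 1 := by
  have hm := pos_of_connected hD
  rw [b_eq_idxOf_add_one _ s.pos_total, b_eq_idxOf_add_one _ hm, s.word_insert hR hD,
    List.idxOf_cons_ne _ (by decide), List.idxOf_append_of_mem (D.true_mem_word hm)]

theorem monomial_insert {A : Type*} [CommSemiring A] (f : ℕ → A) (hR : R.Connected)
    (hD : D.Connected) :
    (s.insert R D).monomial f = R.monomial f * f (R.b - 1) * D.monomial f := by
  have hk := s.pos
  rw [monomial_eq_wordMonomial _ _ s.pos_total, monomial_eq_wordMonomial _ _ hk,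
    monomial_eq_wordMonomial _ _ (pos_of_connected hD), s.word_insert hR hD,
    wordMonomial_false_cons]
  rcases (Nat.succ_le_of_lt hk).eq_or_lt with h | h
  · rw [word_eq_singleton_true h.symm, b_eq_one h.symm, wordMonomial_singleton_true,
      List.tail_cons, List.append_nil, one_mul]
  · obtain ⟨v, hv, hRv⟩ := exists_word_eq_false_cons hR h
    obtain ⟨u, hu⟩ := List.getLast?_eq_some_iff.1 (D.getLast?_word (pos_of_connected hD))
    rw [b_eq_idxOf_add_one _ hk, hRv, hu, List.tail_cons, List.append_assoc,
      List.singleton_append, wordMonomial_append f u hv, wordMonomial_false_cons,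
      List.idxOf_cons_ne _ (by decide), Nat.add_sub_cancel]
    ring

end InsertionShape

namespace RootedChordDiagram

variable {n : ℕ} {C : RootedChordDiagram n}

/-- The connected component of the chord through the second point in the intersection graph
without the first chord. It is the part of the diagram that was inserted last. -/
def firstComponent (C : RootedChordDiagram n) (hn : 0 < n) : Finset C.Chord :=
  componentIn C.intersectionGraph (Finset.univ.erase (C.root hn)) (C.chordAt ⟨1, by omega⟩)

theorem root_notMem_firstComponent (hn : 0 < n) : C.root hn ∉ C.firstComponent hn := fun h =>
  Finset.notMem_erase _ _ (componentIn_subset _ _ _ h)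

theorem mem_firstComponent_of_adj {hn : 0 < n} {a b : C.Chord} (ha : a ∈ C.firstComponent hn)
    (hb : b ≠ C.root hn) (hab : C.intersectionGraph.Adj a b) : b ∈ C.firstComponent hn :=
  mem_componentIn_of_adj _ ha (Finset.mem_erase.2 ⟨hb, Finset.mem_univ b⟩) hab

theorem chordAt_one_ne_root (hC : C.Connected) (hn : 1 < n) :
    C.chordAt ⟨1, by omega⟩ ≠ C.root hn.pos := by
  intro h
  obtain ⟨c, hc₁, hc₂⟩ := exists_chord_straddling hC (g := 1) (by omega)
  have hroot : C.1 (C.root hn.pos).1 = ⟨1, by omega⟩ :=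
    ((C.chordAt_eq_iff.1 h).resolve_left fun h => by simpa [root_fst] using congrArg Fin.val h).symm
  rcases Nat.le_one_iff_eq_zero_or_eq_one.1 hc₁ with hc | hc
  · have hc' : c = C.root hn.pos := Subtype.ext (Fin.ext hc)
    simp [hc', hroot] at hc₂
  · have hc' : c.1 = C.1 (C.root hn.pos).1 := (Fin.ext hc).trans hroot.symm
    rw [hc', partner_partner, root_fst] at hc₂
    omega

theorem chordAt_one_mem_firstComponent (hC : C.Connected) (hn : 1 < n) :
    C.chordAt ⟨1, by omega⟩ ∈ C.firstComponent hn.pos :=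
  self_mem_componentIn _ (Finset.mem_erase.2 ⟨chordAt_one_ne_root hC hn, Finset.mem_univ _⟩)

theorem nested_iff_of_adj {a b c : C.Chord} (hab : C.intersectionGraph.Adj a b)
    (hac : ¬ C.intersectionGraph.Adj a c) (hbc : ¬ C.intersectionGraph.Adj b c) :
    c.1 < a.1 ∧ a.1 < C.1 c.1 ↔ c.1 < b.1 ∧ b.1 < C.1 c.1 := by
  have hne {d e : C.Chord} (h : d ≠ e) : d.1 ≠ e.1 ∧ C.1 d.1 ≠ C.1 e.1 :=
    ⟨fun h' => h (Subtype.ext h'), fun h' => h (Subtype.ext (C.partner_injective h'))⟩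
  have ha := hne (show a ≠ c from fun h => hbc (h ▸ hab.symm))
  have hb := hne (show b ≠ c from fun h => hac (h ▸ hab))
  have := a.2
  have := b.2
  have := c.2
  simp only [intersectionGraph, Edge] at hab hac hbc
  omega

theorem not_nested_of_mem_firstComponent (hC : C.Connected) (hn : 1 < n) {a c : C.Chord}
    (ha : a ∈ C.firstComponent hn.pos) (hc : c ∉ C.firstComponent hn.pos)
    (hroot : c ≠ C.root hn.pos) : ¬ (c.1 < a.1 ∧ a.1 < C.1 c.1) := by
  let K := C.firstComponent hn.pos
  have hnadj {d : C.Chord} (hd : d ∈ K) : ¬ C.intersectionGraph.Adj d c := fun h =>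
    hc (mem_firstComponent_of_adj hd hroot h)
  have h : a ∈ K ∧ ¬ (c.1 < a.1 ∧ a.1 < C.1 c.1) := by
    refine componentIn_induction _ (P := fun a => a ∈ K ∧ ¬ (c.1 < a.1 ∧ a.1 < C.1 c.1)) ha
      ⟨chordAt_one_mem_firstComponent hC hn, fun h => hroot ?_⟩ ?_
    · have hlt : (c.1 : ℕ) < 1 := h.1.trans_le (min_le_left _ _)
      exact Subtype.ext (Fin.ext (by rw [root_fst]; omega))
    · rintro d e ⟨hd, hdc⟩ - he hde
      have heK := mem_firstComponent_of_adj hd (Finset.ne_of_mem_erase he) hde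
      exact ⟨heK, (nested_iff_of_adj hde (hnadj hd) (hnadj heK)).not.1 hdc⟩
  exact h.2

theorem lt_fst_iff_lt_snd (hC : C.Connected) (hn : 1 < n) {z : Fin (2 * n)} {c : C.Chord}
    (hz : C.chordAt z ∈ C.firstComponent hn.pos) (hc : c ∉ C.firstComponent hn.pos)
    (hroot : c ≠ C.root hn.pos) : z < c.1 ↔ z < C.1 c.1 := by
  have hnested := not_nested_of_mem_firstComponent hC hn hz hc hroot
  have hnadj : ¬ C.intersectionGraph.Adj (C.chordAt z) c := fun h =>
    hc (mem_firstComponent_of_adj hz hroot h)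
  have hne : C.chordAt z ≠ c := ne_of_mem_of_not_mem hz hc
  have hz₁ : z ≠ c.1 := fun h => hne (C.chordAt_eq_iff.2 (Or.inl h))
  have hz₂ : z ≠ C.1 c.1 := fun h => hne (C.chordAt_eq_iff.2 (Or.inr h))
  have hfst : (C.chordAt z).1 ≠ c.1 := fun h => hne (Subtype.ext h)
  have hc := c.2
  have hzz := (C.chordAt z).2
  simp only [intersectionGraph, Edge] at hnadj
  rcases C.chordAt_eq_iff.1 (rfl : C.chordAt z = _) with h | h
  · rw [← h] at hnested
    omega
  · rw [← h] at hnadj hzz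
    omega

theorem lt_snd_iff_lt_snd_root (hC : C.Connected) (hn : 1 < n) {z : Fin (2 * n)} {c : C.Chord}
    (hz : C.chordAt z ∈ C.firstComponent hn.pos) (hc : c ∉ C.firstComponent hn.pos) :
    z < C.1 c.1 ↔ z < C.1 (C.root hn.pos).1 := by
  let P (c : C.Chord) : Prop :=
    c ∉ C.firstComponent hn.pos → (z < C.1 c.1 ↔ z < C.1 (C.root hn.pos).1)
  refine reachable_induction (P := P) (hC.preconnected (C.root hn.pos) c) (fun _ => Iff.rfl)
    (fun a b ha hab hb => ?_) hc
  by_cases hbroot : b = C.root hn.pos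
  · rw [hbroot]
  have haK : a ∉ C.firstComponent hn.pos := fun h =>
    hb (mem_firstComponent_of_adj h hbroot hab)
  have hbz := lt_fst_iff_lt_snd hC hn hz hb hbroot
  rw [← ha haK]
  rcases hab with h | h
  · omega
  · have haroot : a ≠ C.root hn.pos := fun h' => (C.root_le _ b).not_gt (h' ▸ h.1)
    have haz := lt_fst_iff_lt_snd hC hn hz haK haroot
    omega

theorem lt_iff_lt_snd_root (hC : C.Connected) (hn : 1 < n) {y z : Fin (2 * n)}
    (hz : C.chordAt z ∈ C.firstComponent hn.pos)
    (hy : C.chordAt y ∉ C.firstComponent hn.pos) (hy₀ : (y : ℕ) ≠ 0) :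
    z < y ↔ z < C.1 (C.root hn.pos).1 := by
  rw [← lt_snd_iff_lt_snd_root hC hn hz hy]
  rcases C.chordAt_eq_iff.1 (rfl : C.chordAt y = _) with h | h
  · have hroot : C.chordAt y ≠ C.root hn.pos := fun h' => hy₀ (by rw [h, h', root_fst])
    rw [← lt_fst_iff_lt_snd hC hn hz hy hroot, ← h]
  · rw [← h]

open Finset in
theorem exists_erase_filter_eq_Icc (hC : C.Connected) (hn : 1 < n) :
    ∃ a b : Fin (2 * n),
      ({y | C.chordAt y ∈ (C.firstComponent hn.pos)ᶜ} : Finset _).erase (C.root hn.pos).1 =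
        Icc a b := by
  set N := ({y | C.chordAt y ∈ (C.firstComponent hn.pos)ᶜ} : Finset _).erase (C.root hn.pos).1
    with hN
  have hmem (y : Fin (2 * n)) :
      y ∈ N ↔ (y : ℕ) ≠ 0 ∧ C.chordAt y ∉ C.firstComponent hn.pos := by
    rw [hN, mem_erase, Fin.ne_iff_vne, root_fst, mem_filter_univ, mem_compl]
  have hne : N.Nonempty :=
    ⟨C.1 (C.root hn.pos).1, (hmem _).2 ⟨Nat.ne_zero_of_lt (C.root hn.pos).2, by
      rw [chordAt_partner, chordAt_fst]
      exact root_notMem_firstComponent _⟩⟩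
  refine ⟨N.min' hne, N.max' hne, Subset.antisymm (fun y hy => ?_) fun y hy => ?_⟩
  · exact mem_Icc.2 ⟨N.min'_le y hy, N.le_max' y hy⟩
  · obtain ⟨ha, hb⟩ := mem_Icc.1 hy
    have ha' := (hmem _).1 (N.min'_mem hne)
    have hb' := (hmem _).1 (N.max'_mem hne)
    refine (hmem y).2 ⟨by omega, fun hz => ?_⟩
    have hlt : y < N.max' hne := hb.lt_of_ne fun h => hb'.2 (h ▸ hz)
    rw [lt_iff_lt_snd_root hC hn hz hb'.2 hb'.1, ← lt_iff_lt_snd_root hC hn hz ha'.2 ha'.1] at hlt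
    exact ha.not_gt hlt

theorem exists_mem_firstComponent_edge_root (hC : C.Connected) (hn : 1 < n) :
    ∃ c ∈ C.firstComponent hn.pos, C.Edge (C.root hn.pos) c := by
  by_contra! h
  refine root_notMem_firstComponent hn.pos (reachable_induction
    (hC.preconnected (C.chordAt ⟨1, by omega⟩) (C.root hn.pos))
    (chordAt_one_mem_firstComponent hC hn) fun a b ha hab => ?_)
  refine mem_firstComponent_of_adj ha (fun hb => h a ha ?_) hab
  refine C.edge_iff_adj_and_lt.2 ⟨hb ▸ hab.symm, (C.root_le _ a).lt_of_ne fun h => ?_⟩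
  exact root_notMem_firstComponent hn.pos (h ▸ ha)

open Finset in
theorem exists_insertionShape (hC : C.Connected) (hn : 1 < n) :
    ∃ (k m : ℕ) (s : InsertionShape k m n),
      ∀ y, y ∈ Set.range s.inner ↔ C.chordAt y ∈ C.firstComponent hn.pos := by
  obtain ⟨a, b, hab⟩ := exists_erase_filter_eq_Icc hC hn
  set K := C.firstComponent hn.pos
  have hroot : C.root hn.pos ∈ Kᶜ := mem_compl.2 (root_notMem_firstComponent _)
  have hmem (y : Fin (2 * n)) : C.chordAt y ∈ K ↔ (y : ℕ) ≠ 0 ∧ ¬ (a ≤ y ∧ y ≤ b) := by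
    have hzero (hy : C.chordAt y ∈ K) : y ≠ (C.root hn.pos).1 := fun h =>
      mem_compl.1 hroot (by rwa [h, chordAt_fst] at hy)
    rw [← mem_Icc, ← hab, mem_erase, mem_filter_univ, mem_compl, ← root_fst C hn.pos,
      ← Fin.ne_iff_vne]
    tauto
  have hcard : (b : ℕ) + 1 - a + 1 = 2 * #Kᶜ := by
    rw [← card_filter_chordAt_mem, ← Fin.card_Icc, ← hab, card_erase_add_one]
    simpa [chordAt_fst] using hroot
  have hcompl : #Kᶜ + #K = n := by rw [card_compl_add_card, card_chord]
  have hone : ¬ ((a : ℕ) ≤ 1 ∧ 1 ≤ (b : ℕ)) :=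
    ((hmem _).1 (chordAt_one_mem_firstComponent hC hn)).2
  obtain ⟨c, hcK, -, hc, hclt⟩ := exists_mem_firstComponent_edge_root hC hn
  have hlast : C.chordAt (C.1 c.1) ∈ K := by rwa [chordAt_partner, chordAt_fst]
  have hsnd : C.chordAt (C.1 (C.root hn.pos).1) ∉ K := by
    rw [chordAt_partner, chordAt_fst]
    exact mem_compl.1 hroot
  rw [hmem] at hlast hsnd
  refine ⟨#Kᶜ, #K, ⟨a - 2, card_pos.2 ⟨_, hroot⟩, by omega, hcompl⟩, fun y => ?_⟩
  rw [InsertionShape.mem_range_inner_iff, hmem]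
  dsimp only
  omega

end RootedChordDiagram

namespace InsertionShape

open RootedChordDiagram

variable {k m n : ℕ} (s : InsertionShape k m n)

theorem mem_range_outer_iff {y : Fin (2 * n)} :
    y ∈ Set.range s.outer ↔ y ∉ Set.range s.inner := by
  revert y
  rw [s.forall_point]
  simp [outer_ne_inner, (outer_ne_inner _ _ _).symm]

theorem exists_eq_insert_of_mem_range {C : RootedChordDiagram n}
    (hC : ∀ y ∈ Set.range s.inner, C.1 y ∈ Set.range s.inner) : ∃ R D, C = s.insert R D := by
  choose D hD using fun x => hC (s.inner x) ⟨x, rfl⟩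
  have houter (x : Fin (2 * k)) : C.1 (s.outer x) ∈ Set.range s.outer := by
    rw [mem_range_outer_iff]
    intro h
    have := hC _ h
    rw [partner_partner] at this
    exact s.mem_range_outer_iff.1 ⟨x, rfl⟩ this
  choose R hR using houter
  have hR' : (∀ x, R (R x) = x) ∧ ∀ x, R x ≠ x := by
    simp only [← s.outer_strictMono.injective.eq_iff, ne_eq, hR, partner_partner, partner_ne,
      not_false_eq_true, implies_true, and_self]
  have hD' : (∀ x, D (D x) = x) ∧ ∀ x, D x ≠ x := by
    simp only [← s.inner_strictMono.injective.eq_iff, ne_eq, hD, partner_partner, partner_ne,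
      not_false_eq_true, implies_true, and_self]
  exact ⟨⟨R, hR'⟩, ⟨D, hD'⟩, (s.eq_insert_iff _ _).2 ⟨fun x => (hR x).symm, fun x => (hD x).symm⟩⟩

variable {R : RootedChordDiagram k} {D : RootedChordDiagram m}

theorem connected_of_insert_connected (h : (s.insert R D).Connected) : R.Connected := by
  rw [connected_iff R s.pos]
  intro r
  refine reachable_induction
    (P := fun c => ∀ r, c = s.outerChord R D r → R.intersectionGraph.Reachable (R.root s.pos) r)
    (h.preconnected (s.outerChord R D (R.root s.pos)) (s.outerChord R D r))
    (fun r hr => ?_) (fun a b ha hab r hb => ?_) r rfl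
  · rw [(s.outerChord R D).injective hr]
  · subst hb
    revert a
    rw [s.forall_chord]
    refine ⟨fun r' hr' h => ?_, fun d _ h => ?_⟩
    · exact (hr' r' rfl).trans ((s.adj_outerChord R D r' r).1 h).reachable
    · rw [s.eq_root_of_adj h.symm]

theorem chordAt_one (hm : 0 < m) (h : 1 < 2 * n) :
    (s.insert R D).chordAt ⟨1, h⟩ = s.innerChord R D (D.root hm) :=
  (chordAt_eq_iff _).2 <| Or.inl <| Fin.ext <| by
    rw [innerChord_fst, inner_val, root_fst, if_pos (Nat.zero_le _)]

theorem chordAt_mem_firstComponent_insert_iff (hD : D.Connected) {y : Fin (2 * n)} :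
    (s.insert R D).chordAt y ∈ (s.insert R D).firstComponent s.pos_total ↔
      y ∈ Set.range s.inner := by
  have hcomponent : (s.insert R D).firstComponent s.pos_total =
      Finset.univ.map (s.innerChord R D).toEmbedding := by
    rw [firstComponent, s.chordAt_one (pos_of_connected hD), erase_root_eq_union]
    exact (componentIn_union _ (s.not_adj_of_mem_inner_of_mem_outer R)
      (Finset.mem_map_of_mem _ (Finset.mem_univ _))).trans
      (s.componentIn_univ_map_innerChord R hD _)
  revert y
  rw [hcomponent, s.forall_point]
  simp [chordAt_outer, chordAt_inner, (outer_ne_inner _ _ _).symm,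
    (outerChord_ne_innerChord _ _ _ _ _).symm]

theorem shape_eq_of_insert_eq {k' m' : ℕ} {s' : InsertionShape k' m' n}
    {R' : RootedChordDiagram k'} {D' : RootedChordDiagram m'} (hD : D.Connected)
    (hD' : D'.Connected) (h : s.insert R D = s'.insert R' D') :
    k = k' ∧ m = m' ∧ s.gap = s'.gap := by
  apply eq_of_range_inner_eq
  ext y
  rw [← s.chordAt_mem_firstComponent_insert_iff (R := R) hD,
    ← s'.chordAt_mem_firstComponent_insert_iff (R := R') hD', h]

theorem connected_of_forall_mem_firstComponent (hm : 0 < m) (hn : 0 < n)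
    (h : ∀ d, s.innerChord R D d ∈ (s.insert R D).firstComponent hn) : D.Connected := by
  rw [connected_iff D hm]
  intro d
  refine componentIn_induction _
    (P := fun c => ∀ d, c = s.innerChord R D d → D.intersectionGraph.Reachable (D.root hm) d)
    (h d) (fun d hd => ?_) (fun a b ha haroot _ hab d hb => ?_) d rfl
  · rw [s.chordAt_one hm] at hd
    rw [(s.innerChord R D).injective hd]
  · subst hb
    replace haroot := Finset.ne_of_mem_erase haroot
    revert a
    rw [s.forall_chord]
    refine ⟨fun r _ hab hr => absurd ?_ hr, fun d' hd' hab _ => ?_⟩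
    · rw [s.eq_root_of_adj hab, outerChord_root]
    · exact (hd' d' rfl).trans ((s.adj_innerChord R D d' d).1 hab).reachable

end InsertionShape

namespace RootedChordDiagram

variable {n : ℕ} {C : RootedChordDiagram n}

theorem exists_eq_insert (hC : C.Connected) (hn : 1 < n) :
    ∃ (k m : ℕ) (s : InsertionShape k m n) (R : RootedChordDiagram k) (D : RootedChordDiagram m),
      R.Connected ∧ D.Connected ∧ C = s.insert R D := by
  obtain ⟨k, m, s, hs⟩ := exists_insertionShape hC hn
  obtain ⟨R, D, rfl⟩ := s.exists_eq_insert_of_mem_range (C := C) fun y hy => by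
    rwa [hs, chordAt_partner, ← hs]
  have hm : 0 < m := by
    have := s.gap_lt
    omega
  refine ⟨k, m, s, R, D, s.connected_of_insert_connected hC, ?_, rfl⟩
  refine s.connected_of_forall_mem_firstComponent (R := R) hm hn.pos fun d => ?_
  rw [← chordAt_fst _ (s.innerChord R D d), ← hs]
  exact ⟨d.1, rfl⟩

end RootedChordDiagram

section Recurrence

open Finset

theorem sum_Icc_one_eq_sum_antidiagonal {M : Type*} [AddCommMonoid M] (F : ℕ → ℕ → M) (j : ℕ) :
    ∑ l ∈ Icc 1 (j + 1), F l (j + 1 - l) = ∑ p ∈ antidiagonal j, F (p.1 + 1) p.2 := by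
  rw [Nat.sum_antidiagonal_eq_sum_range_succ fun l k => F (l + 1) k, range_eq_Ico,
    ← Ico_add_one_right_eq_Icc, ← sum_Ico_add' _ 0 (j + 1) 1]
  simp only [Nat.add_sub_add_right]

theorem eq_sum_choose_smul_of_recurrence {S : Type*} [CommSemiring S] (θ : S →+ S) (a h : ℕ → S)
    (hθ : ∀ l k, θ (h l * a k) = θ (h l) * a k + h l * θ (a k) + h l * a k)
    (ha₀ : θ (a 0) = a 0) (ha : ∀ j, a (j + 1) = h 1 * θ (a j))
    (hh : ∀ l, h (l + 2) = h 1 * θ (h (l + 1))) (j : ℕ) :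
    a (j + 1) = ∑ p ∈ antidiagonal j, (j + 1).choose (p.1 + 1) • (h (p.1 + 1) * a p.2) := by
  induction j with
  | zero => simp [ha, ha₀]
  | succ j ih =>
    have hterm (l k : ℕ) : h 1 * θ (h (l + 1) * a k) =
        h (l + 2) * a k + h (l + 1) * a (k + 1) + h 1 * (h (l + 1) * a k) := by
      rw [hθ, hh, ha]
      ring
    have hleft : ∑ p ∈ antidiagonal (j + 1), (j + 1).choose p.1 • (h (p.1 + 1) * a p.2) =
        h 1 * a (j + 1) +
          ∑ p ∈ antidiagonal j, (j + 1).choose (p.1 + 1) • (h (p.1 + 2) * a p.2) := by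
      rw [Nat.sum_antidiagonal_succ, Nat.choose_zero_right, one_smul]
    have hright : ∑ p ∈ antidiagonal (j + 1), (j + 1).choose (p.1 + 1) • (h (p.1 + 1) * a p.2) =
        ∑ p ∈ antidiagonal j, (j + 1).choose (p.1 + 1) • (h (p.1 + 1) * a (p.2 + 1)) := by
      rw [Nat.sum_antidiagonal_succ', Nat.choose_succ_self, zero_smul, zero_add]
    calc a (j + 2)
        = ∑ p ∈ antidiagonal j, (j + 1).choose (p.1 + 1) • (h 1 * θ (h (p.1 + 1) * a p.2)) := by
          rw [ha, ih, map_sum, mul_sum]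
          simp only [map_nsmul, mul_smul_comm]
      _ = h 1 * a (j + 1) +
            ∑ p ∈ antidiagonal j, (j + 1).choose (p.1 + 1) • (h (p.1 + 2) * a p.2) +
            ∑ p ∈ antidiagonal j, (j + 1).choose (p.1 + 1) • (h (p.1 + 1) * a (p.2 + 1)) := by
          simp only [hterm, smul_add, sum_add_distrib]
          rw [ih, mul_sum]
          simp only [mul_smul_comm]
          abel
      _ = ∑ p ∈ antidiagonal (j + 1), (j + 2).choose (p.1 + 1) • (h (p.1 + 1) * a p.2) := by
          rw [← hleft, ← hright, ← sum_add_distrib]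
          simp only [← add_smul, ← Nat.choose_succ_succ]

end Recurrence

section Series

open Finset PowerSeries

variable {A : Type*} [CommSemiring A]

/-- The operator `2 X d/dX - 1` on power series without constant coefficient. The truncated
subtraction makes it kill the constant coefficient. -/
noncomputable def oddScale : A⟦X⟧ →+ A⟦X⟧ where
  toFun a := PowerSeries.mk fun n => (2 * n - 1 : ℕ) * coeff n a
  map_zero' := by ext; simp
  map_add' a b := by ext; simp [mul_add]

theorem coeff_oddScale (n : ℕ) (a : A⟦X⟧) :
    coeff n (oddScale a) = (2 * n - 1 : ℕ) * coeff n a := by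
  rw [oddScale, AddMonoidHom.coe_mk, ZeroHom.coe_mk, coeff_mk]

theorem oddScale_mul {a b : A⟦X⟧} (ha : constantCoeff a = 0) (hb : constantCoeff b = 0) :
    oddScale (a * b) = oddScale a * b + a * oddScale b + a * b := by
  ext n
  simp only [coeff_oddScale, coeff_mul, map_add, mul_sum, ← sum_add_distrib]
  refine sum_congr rfl fun ⟨p, q⟩ hpq => ?_
  rw [HasAntidiagonal.mem_antidiagonal] at hpq
  dsimp only at hpq ⊢
  rcases p.eq_zero_or_pos with rfl | hp
  · simp [ha]
  rcases q.eq_zero_or_pos with rfl | hq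
  · simp [hb]
  have hodd : 2 * n - 1 = (2 * p - 1) + (2 * q - 1) + 1 := by omega
  rw [hodd]
  push_cast
  ring

theorem coeff_succ_mul_of_constantCoeff_eq_zero {a b : A⟦X⟧} (ha : constantCoeff a = 0)
    (hb : constantCoeff b = 0) (i : ℕ) :
    coeff (i + 1) (a * b) = ∑ k ∈ Icc 1 i, coeff k a * coeff (i + 1 - k) b := by
  rw [coeff_mul, Nat.sum_antidiagonal_succ, coeff_zero_eq_constantCoeff_apply, ha, zero_mul,
    zero_add, ← sum_Icc_one_eq_sum_antidiagonal fun k l => coeff k a * coeff l b,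
    sum_Icc_succ_top (by omega), Nat.sub_self, coeff_zero_eq_constantCoeff_apply, hb, mul_zero,
    add_zero]

end Series

section Sums

open Finset RootedChordDiagram

theorem mem_RCCD {n : ℕ} {C : RootedChordDiagram n} : C ∈ RCCD n ↔ C.Connected :=
  mem_filter_univ C

/-- The arguments of an insertion, without side conditions: the numbers of chords of the diagram
inserted into and of the inserted diagram, the two diagrams, and the gap. -/
abbrev InsertionDatum : Type :=
  Σ p : ℕ × ℕ, RootedChordDiagram p.1 × RootedChordDiagram p.2 × ℕ

/-- The arguments of the insertions that produce a connected diagram with `n` chords from two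
connected diagrams. -/
def insertionData (n : ℕ) : Finset InsertionDatum :=
  (antidiagonal n).sigma fun p => RCCD p.1 ×ˢ RCCD p.2 ×ˢ range (2 * p.2 - 1)

theorem mem_insertionData {n : ℕ} {x : InsertionDatum} :
    x ∈ insertionData n ↔ x.1.1 + x.1.2 = n ∧ x.2.1.Connected ∧ x.2.2.1.Connected ∧
      x.2.2.2 + 1 < 2 * x.1.2 := by
  simp only [insertionData, mem_sigma, HasAntidiagonal.mem_antidiagonal, mem_product, mem_RCCD,
    mem_range, Nat.lt_sub_iff_add_lt]

/-- The shape of the insertion with given data. -/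
def shapeOfMem {n : ℕ} {x : InsertionDatum}
    (hx : x ∈ insertionData n) : InsertionShape x.1.1 x.1.2 n where
  gap := x.2.2.2
  pos := pos_of_connected (mem_insertionData.1 hx).2.1
  gap_lt := (mem_insertionData.1 hx).2.2.2
  add_eq := (mem_insertionData.1 hx).1

theorem eq_of_insert_shapeOfMem_eq {n : ℕ} {x y : InsertionDatum}
    (hx : x ∈ insertionData n) (hy : y ∈ insertionData n)
    (h : (shapeOfMem hx).insert x.2.1 x.2.2.1 = (shapeOfMem hy).insert y.2.1 y.2.2.1) : x = y := by
  obtain ⟨hk, hm, hgap⟩ := (shapeOfMem hx).shape_eq_of_insert_eq (mem_insertionData.1 hx).2.2.1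
    (mem_insertionData.1 hy).2.2.1 h
  obtain ⟨⟨k, m⟩, R, D, g⟩ := x
  obtain ⟨⟨k', m'⟩, R', D', g'⟩ := y
  obtain rfl : k = k' := hk
  obtain rfl : m = m' := hm
  obtain rfl : g = g' := hgap
  obtain ⟨rfl, rfl⟩ := (shapeOfMem hx).insert_injective h
  rfl

variable {A : Type*} [CommSemiring A] (f φ : ℕ → A)

theorem sum_RCCD_eq_sum_insertionData {n : ℕ} (hn : 1 < n) :
    ∑ C ∈ RCCD n, C.monomial f * φ C.b = ∑ x ∈ insertionData n,
      x.2.1.monomial f * f (x.2.1.b - 1) * (x.2.2.1.monomial f * φ (x.2.2.1.b + 1)) := by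
  refine (sum_bij (fun x hx => (shapeOfMem hx).insert x.2.1 x.2.2.1) (fun x hx => ?_)
    (fun x hx y hy h => eq_of_insert_shapeOfMem_eq hx hy h) (fun C hC => ?_)
    (fun x hx => ?_)).symm
  · obtain ⟨-, hR, hD, -⟩ := mem_insertionData.1 hx
    exact mem_RCCD.2 ((shapeOfMem hx).insert_connected hR hD)
  · obtain ⟨k, m, s, R, D, hR, hD, rfl⟩ := exists_eq_insert (mem_RCCD.1 hC) hn
    exact ⟨⟨(k, m), R, D, s.gap⟩, mem_insertionData.2 ⟨s.add_eq, hR, hD, s.gap_lt⟩, rfl⟩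
  · obtain ⟨-, hR, hD, -⟩ := mem_insertionData.1 hx
    rw [(shapeOfMem hx).monomial_insert f hR hD, (shapeOfMem hx).b_insert hR hD,
      mul_assoc _ _ (φ _)]

theorem sum_RCCD_eq_sum_antidiagonal {n : ℕ} (hn : 1 < n) :
    ∑ C ∈ RCCD n, C.monomial f * φ C.b = ∑ p ∈ antidiagonal n,
      (∑ R ∈ RCCD p.1, R.monomial f * f (R.b - 1)) *
        ((2 * p.2 - 1 : ℕ) * ∑ D ∈ RCCD p.2, D.monomial f * φ (D.b + 1)) := by
  rw [sum_RCCD_eq_sum_insertionData f φ hn, insertionData, sum_sigma]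
  refine sum_congr rfl fun p _ => ?_
  rw [mul_sum, sum_mul_sum]
  simp only [sum_product, sum_const, card_range, nsmul_eq_mul]
  refine sum_congr rfl fun R _ => sum_congr rfl fun D _ => ?_
  ring

theorem RCCD_zero : RCCD 0 = ∅ :=
  eq_empty_of_forall_notMem fun _ hC => (pos_of_connected (mem_RCCD.1 hC)).false

open PowerSeries

/-- The generating series of the connected diagrams by number of chords, where `C` has weight
`C.monomial f * φ C.b`. -/
noncomputable def diagramSeries : A⟦X⟧ :=
  PowerSeries.mk fun n => ∑ C ∈ RCCD n, C.monomial f * φ C.b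

theorem coeff_diagramSeries (n : ℕ) :
    coeff n (diagramSeries f φ) = ∑ C ∈ RCCD n, C.monomial f * φ C.b :=
  coeff_mk _ _

theorem constantCoeff_diagramSeries : constantCoeff (diagramSeries f φ) = 0 := by
  rw [← coeff_zero_eq_constantCoeff_apply, coeff_diagramSeries, RCCD_zero, sum_empty]

variable {φ}

theorem diagramSeries_eq_mul_oddScale (hφ : φ 1 = 0) :
    diagramSeries f φ =
      diagramSeries f (fun b => f (b - 1)) * oddScale (diagramSeries f fun b => φ (b + 1)) := by
  ext n
  rw [coeff_mul]
  simp only [coeff_oddScale, coeff_diagramSeries]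
  rcases Nat.lt_or_ge 1 n with hn | hn
  · exact sum_RCCD_eq_sum_antidiagonal f φ hn
  interval_cases n
  · simp [RCCD_zero]
  · rw [Nat.antidiagonal_succ]
    simp [RCCD_zero, b_eq_one, hφ]

theorem oddScale_diagramSeries_eq_self (hφ : ∀ b, 1 < b → φ b = 0) :
    oddScale (diagramSeries f φ) = diagramSeries f φ := by
  ext n
  rw [coeff_oddScale, coeff_diagramSeries]
  rcases Nat.lt_or_ge 1 n with hn | hn
  · rw [sum_eq_zero, mul_zero]
    intro C hC
    obtain ⟨v, -, hv⟩ := exists_word_eq_false_cons (mem_RCCD.1 hC) hn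
    rw [hφ, mul_zero]
    rw [b_eq_idxOf_add_one _ hn.pos, hv, List.idxOf_cons_ne _ (by decide)]
    omega
  · interval_cases n <;> simp [RCCD_zero]

variable {f}

theorem diagramSeries_congr {ψ : ℕ → A} (h : ∀ b, 0 < b → φ b = ψ b) :
    diagramSeries f φ = diagramSeries f ψ := by
  ext n
  rw [coeff_diagramSeries, coeff_diagramSeries]
  refine sum_congr rfl fun C hC => ?_
  rw [h _ (b_pos C (pos_of_connected (mem_RCCD.1 hC)))]

variable (f)

theorem coeff_diagramSeries_ite (p : ℕ → Prop) [DecidablePred p] (n : ℕ) :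
    coeff n (diagramSeries f fun b => if p b then φ b else 0) =
      ∑ C ∈ RCCD n with p C.b, C.monomial f * φ C.b := by
  simp only [coeff_diagramSeries, mul_ite, mul_zero, sum_filter]

theorem diagramSeries_indicator_eq_sum_Icc {j : ℕ} (hj : 1 ≤ j) :
    diagramSeries f (fun b => if b = j + 1 then 1 else 0) = ∑ l ∈ Icc 1 j, j.choose l •
      (diagramSeries f (fun b => if l ≤ b then f (b - l) else 0) *
        diagramSeries f (fun b => if b = j - l + 1 then 1 else 0)) := by
  obtain ⟨j, rfl⟩ := Nat.exists_eq_add_of_le' hj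
  let h (l : ℕ) := diagramSeries f fun b => if l ≤ b then f (b - l) else 0
  let a (j : ℕ) := diagramSeries f fun b => if b = j + 1 then 1 else 0
  have hroot : h 1 = diagramSeries f fun b => f (b - 1) :=
    diagramSeries_congr fun b hb => if_pos hb
  refine (eq_sum_choose_smul_of_recurrence oddScale a h (fun l k => ?_) ?_ (fun j => ?_)
    (fun l => ?_) j).trans
    (sum_Icc_one_eq_sum_antidiagonal (fun l k => (j + 1).choose l • (h l * a k)) j).symm
  · exact oddScale_mul (constantCoeff_diagramSeries _ _) (constantCoeff_diagramSeries _ _)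
  · exact oddScale_diagramSeries_eq_self f fun b hb => if_neg hb.ne'
  · refine (diagramSeries_eq_mul_oddScale f (if_neg (by omega))).trans ?_
    simp only [hroot, a, add_left_inj]
  · refine (diagramSeries_eq_mul_oddScale f (if_neg (by omega))).trans ?_
    simp only [hroot, h, Nat.reduceLeDiff, Nat.add_sub_add_right]

end Sums

theorem mainTheorem3 {R : Type*} [CommSemiring R] (f : ℕ → R) (i j : ℕ) (hi : 1 ≤ i) (hj : 1 ≤ j) :
    ∑ C ∈ RCCD (i + 1) with C.b = j + 1, C.monomial f =
      ∑ k ∈ Finset.Icc 1 i, ∑ l ∈ Finset.Icc 1 j, (j.choose l : R) *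
        (∑ C ∈ RCCD k with l ≤ C.b, C.monomial f * f (C.b - l)) *
        (∑ C ∈ RCCD (i - k + 1) with C.b = j - l + 1, C.monomial f) := by
  have hcoeff := congrArg (PowerSeries.coeff (i + 1)) (diagramSeries_indicator_eq_sum_Icc f hj)
  simp only [map_sum, map_nsmul, coeff_succ_mul_of_constantCoeff_eq_zero
    (constantCoeff_diagramSeries f _) (constantCoeff_diagramSeries f _)] at hcoeff
  simp only [coeff_diagramSeries_ite, mul_one, nsmul_eq_mul,
    Finset.mul_sum (Finset.Icc 1 i)] at hcoeff
  rw [hcoeff, Finset.sum_comm]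
  refine Finset.sum_congr rfl fun k hk => Finset.sum_congr rfl fun l _ => ?_
  rw [Nat.sub_add_comm (Finset.mem_Icc.1 hk).2, mul_assoc]
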